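/- Let $G$ be a finite undirected graph with vertex set $V$, a set $E_b$ of full (bulk) edges $(x,y)$ joining two vertices, and a set $E_\partial$ of half-edges $(x,\cdot)$, each attached to one vertex $x$; put $E=E_b\sqcup E_\partial$ (loops, multiple edges and several half-edges at one vertex are allowed, and $G$ need not be connected). Let $D\ge 1$ be an integer. Attach a copy of $\mathbb{C}^D$ to each half-edge and to each of the two ends of each bulk edge, and let $\mathcal H_x$ be the tensor product of the copies attached at $x\in V$. Let $g_x\in\mathcal H_x$, $x\in V$, be independent random vectors whose coordinates in the product basis are i.i.d. standard complex Gaussians (centred, independent real and imaginary parts of variance $1/2$). For $e\in E_b$ let $|\Omega_e\rangle=D^{-1/2}\sum_{i=1}^D|i,i\rangle$ be the maximally entangled state on the two ends of $e$, and let $$|\psi_G\rangle=\Big\langle\bigotimes_{e\in E_b}\Omega_e\,\Big|\,\bigotimes_{x\in V}g_x\Big\rangle\in(\mathbb{C}^D)^{\otimes|E_\partial|}$$ be the partial inner product over the bulk edges. For $A\subseteq E_\partial$ and $B=E_\partial\setminus A$ let $\rho_A=\operatorname{Tr}_B|\psi_G\rangle\langle\psi_G|$. For a permutation $\sigma$ in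 the symmetric group $\mathcal S_n$ let $|\sigma|=n-\#(\sigma)$, where $\#(\sigma)$ is the number of cycles of $\sigma$ (fixed points included), so that $|\sigma^{-1}\tau|$ is the Cayley distance of $\sigma$ and $\tau$. Let $\gamma=(n\;n-1\;\cdots\;1)\in\mathcal S_n$ and, for $\alpha=(\alpha_x)_{x\in V}\in\mathcal S_n^{|V|}$, $$H_G^{(n)}(\alpha)=\sum_{(x,\cdot)\in A}|\gamma^{-1}\alpha_x|+\sum_{(x,\cdot)\in B}|\mathrm{id}^{-1}\alpha_x|+\sum_{(x,y)\in E_b}|\alpha_x^{-1}\alpha_y|.$$ Then for every $A\subseteq E_\partial$ and every integer $n\ge 1$ the random variable $\operatorname{Tr}(\rho_A^n)$ is integrable and $$\mathbb E\big[\operatorname{Tr}(\rho_A^n)\big]=\sum_{\alpha\in\mathcal S_n^{|V|}}D^{\,n|E|-n|E_b|-H_G^{(n)}(\alpha)}.$$ -/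

import Mathlib

open MeasureTheory ProbabilityTheory

/-- A graph with vertex set `V`, bulk (full) edges `Eb` and boundary edges (half-edges) `Ed`.
Each bulk edge has two end points and each half-edge is attached to one vertex; loops and multiple
edges are allowed.  The graph is undirected: calling the ends of a bulk edge first and second is
only a way to name them. -/
structure OpenGraph (V Eb Ed : Type*) where
  fst : Eb → V
  snd : Eb → V
  root : Ed → V

namespace OpenGraph

variable {V Eb Ed : Type*} (G : OpenGraph V Eb Ed)

/-- The vertex at which a leg sits.  The legs of the graph are the half-edges `Sum.inl e` and the two
ends `Sum.inr (e, false)`, `Sum.inr (e, true)` of each bulk edge `e`; every leg carries one tensor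
factor `ℂ^D`. -/
def legVertex : Ed ⊕ Eb × Bool → V
  | Sum.inl e => G.root e
  | Sum.inr (e, false) => G.fst e
  | Sum.inr (e, true) => G.snd e

/-- The index set of the product basis of the local Hilbert space `H_x`, the tensor product of one
copy of `ℂ^D` for each leg at `x`.  A vector of `H_x` is a function `G.LocalIndex D x → ℂ`. -/
abbrev LocalIndex (D : ℕ) (x : V) : Type _ :=
  {l : Ed ⊕ Eb × Bool // G.legVertex l = x} → Fin D

end OpenGraph

noncomputable section

/-- The maximally entangled state `D^{-1/2} ∑ i, |i, i⟩` of `ℂ^D ⊗ ℂ^D`, in the product basis. -/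
def maxEntangled (D : ℕ) (i j : Fin D) : ℂ :=
  if i = j then ((1 / Real.sqrt (D : ℝ) : ℝ) : ℂ) else 0

namespace OpenGraph

variable {V Eb Ed : Type*} (G : OpenGraph V Eb Ed)

/-- The tensor product of the vertex states `g x ∈ H_x`, in the product basis of the tensor product
of one copy of `ℂ^D` for each leg of the graph. -/
def vertexState [Fintype V] (D : ℕ) (g : (x : V) → G.LocalIndex D x → ℂ)
    (i : Ed ⊕ Eb × Bool → Fin D) : ℂ :=
  ∏ x : V, g x (fun l => i l.1)

/-- The tensor product of the maximally entangled states of all bulk edges. -/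
def edgeState (Eb : Type*) [Fintype Eb] (D : ℕ) (j : Eb × Bool → Fin D) : ℂ :=
  ∏ e : Eb, maxEntangled D (j (e, false)) (j (e, true))

/-- The tensor network state `|ψ_G⟩ = ⟨⨂_e Ω_e | ⨂_x g_x⟩`, the partial inner product over the legs
of the bulk edges; it is a vector in the tensor product of `ℂ^D` over the half-edges. -/
def networkState [Fintype V] [Fintype Eb] [DecidableEq Eb] (D : ℕ)
    (g : (x : V) → G.LocalIndex D x → ℂ) (b : Ed → Fin D) : ℂ :=
  ∑ j : Eb × Bool → Fin D, star (edgeState Eb D j) * G.vertexState D g (Sum.elim b j)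

end OpenGraph

/-- The partial trace over the factors outside `A` of an operator on the tensor product of `ℂ^D` over
`Ed`, as an operator on the tensor product of `ℂ^D` over `A`. -/
def partialTraceCompl {Ed : Type*} [Fintype Ed] [DecidableEq Ed] (D : ℕ) (A : Finset Ed)
    (M : Matrix (Ed → Fin D) (Ed → Fin D) ℂ) :
    Matrix ({e // e ∈ A} → Fin D) ({e // e ∈ A} → Fin D) ℂ :=
  fun a a' => ∑ b : {e // e ∉ A} → Fin D,
    M ((Equiv.piEquivPiSubtypeProd (fun e => e ∈ A) (fun _ => Fin D)).symm (a, b))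
      ((Equiv.piEquivPiSubtypeProd (fun e => e ∈ A) (fun _ => Fin D)).symm (a', b))

/-- The reduced operator `ρ_A = Tr_B |ψ_G⟩⟨ψ_G|`, where `B` is the complement of `A`. -/
def OpenGraph.reducedState {V Eb Ed : Type*} (G : OpenGraph V Eb Ed) [Fintype V] [Fintype Eb]
    [DecidableEq Eb] [Fintype Ed] [DecidableEq Ed] (D : ℕ) (A : Finset Ed)
    (g : (x : V) → G.LocalIndex D x → ℂ) :
    Matrix ({e // e ∈ A} → Fin D) ({e // e ∈ A} → Fin D) ℂ :=
  partialTraceCompl D A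
    (Matrix.vecMulVec (G.networkState D g) (star (G.networkState D g)))

/-- The standard complex Gaussian law: independent real and imaginary parts, each centred with
variance `1/2`, so that `E |z|^2 = 1`. -/
def stdComplexGaussian : Measure ℂ :=
  ((gaussianReal 0 (1 / 2)).prod (gaussianReal 0 (1 / 2))).map
    (fun p : ℝ × ℝ => (p.1 : ℂ) + (p.2 : ℂ) * Complex.I)

/-- The number of cycles of a permutation, fixed points included (the number of its orbits). -/
def numCycles {n : ℕ} (σ : Equiv.Perm (Fin n)) : ℕ :=
  Nat.card (Quotient (Equiv.Perm.SameCycle.setoid σ))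

/-- The Cayley distance `|α⁻¹ β| = n - #(α⁻¹ β)` on the permutations of `n` points. -/
def cayleyDist {n : ℕ} (α β : Equiv.Perm (Fin n)) : ℤ :=
  (n : ℤ) - (numCycles (α⁻¹ * β) : ℤ)

/-- The total cycle `(n n-1 … 1)`, that is `k ↦ k - 1` cyclically. -/
def totalCycle (n : ℕ) : Equiv.Perm (Fin n) := (finRotate n)⁻¹

/-- The Hamiltonian of a configuration `α` of permutations on the vertices: half-edges in `A` are
compared with the total cycle, those outside `A` with the identity, and the two ends of each bulk
edge with one another. -/
def OpenGraph.hamiltonian {V Eb Ed : Type*} (G : OpenGraph V Eb Ed) [Fintype Eb] [Fintype Ed]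
    [DecidableEq Ed] (A : Finset Ed) (n : ℕ) (α : V → Equiv.Perm (Fin n)) : ℤ :=
  ∑ e ∈ A, cayleyDist (totalCycle n) (α (G.root e))
    + ∑ e ∈ Aᶜ, cayleyDist 1 (α (G.root e))
    + ∑ e : Eb, cayleyDist (α (G.fst e)) (α (G.snd e))

end

/-!
The proof is Wick's formula followed by a count of the values carried by the edges.

The maximally entangled states identify the values at the two ends of each bulk edge, so a component
of `ψ_G` is `D ^ (-|E_b| / 2)` times a sum, over a value for each bulk edge, of products of
coordinates of the `g x`. Writing out the matrix power and the partial trace, `Tr (ρ_A ^ n)` becomes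
`D ^ (-n |E_b|)` times a sum over one value for each half-edge and replica, and two values for each
bulk edge and replica (one in the ket and one in the bra), of a product of coordinates of the `g x`
and of their conjugates (`OpenGraph.trace_reducedState_pow`). At a half-edge, the value in the
bra of replica `k` is the one in the ket of replica `k + 1` on `A`, and of replica `k` off `A`; this
is recorded by `boundaryPerm`.

The moments `E[z ^ m * conj z ^ m']` are `m!` if `m = m'` and zero otherwise
(`integral_pow_mul_star_pow_stdComplexGaussian`). Since `∏ i, (m i)!` is the number of permutations
matching two words in which each letter `i` occurs `m i` times (`card_perm_comp_eq`), independence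
turns the expectation of each term into the number of configurations `α` of permutations on the
vertices that match the local indices of kets and bras
(`integral_prod_mul_star_eq_prod_sum_perm`).

For a fixed `α`, the matching conditions concern one leg at a time, so the sum over values factorizes
over the edges. A half-edge at `x` contributes the number of functions of the replicas that are
invariant under `γ⁻¹ α_x` or `α_x`, and a bulk edge those invariant under `α_x⁻¹ α_y`. Such a
function is a choice of one of `D` values on each cycle (`card_comp_perm_eq_self`), and
`#(σ) = n - |σ|` gives the exponent.
-/

/-! ### Traces of matrix powers -/

/-- The sum over paths of `m + 1` steps from `i` to `j`, with intermediate points `p`. -/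
theorem Matrix.pow_succ_apply_eq_sum_prod {ι R : Type*} [Fintype ι] [DecidableEq ι]
    [CommSemiring R] (M : Matrix ι ι R) (m : ℕ) (i j : ι) :
    (M ^ (m + 1)) i j = ∑ p : Fin m → ι, ∏ k : Fin (m + 1),
      M ((Fin.cons i p : Fin (m + 1) → ι) k) ((Fin.snoc p j : Fin (m + 1) → ι) k) := by
  induction m generalizing i with
  | zero => simp [Fin.snoc]
  | succ m ih =>
    rw [pow_succ', Matrix.mul_apply, ← (Fin.consEquiv fun _ => ι).sum_comp, Fintype.sum_prod_type]
    refine Finset.sum_congr rfl fun l _ => ?_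
    rw [ih, Finset.mul_sum]
    refine Finset.sum_congr rfl fun p _ => ?_
    have hq : (Fin.consEquiv fun _ => ι) (l, p) = (Fin.cons l p : Fin (m + 1) → ι) := rfl
    rw [hq, ← Fin.cons_snoc_eq_snoc_cons, Fin.prod_univ_succ (n := m + 1)]
    simp only [Fin.cons_zero, Fin.cons_succ]

theorem Matrix.trace_pow_eq_sum_prod {ι R : Type*} [Fintype ι] [DecidableEq ι]
    [CommSemiring R] (M : Matrix ι ι R) {n : ℕ} (hn : 1 ≤ n) :
    (M ^ n).trace = ∑ a : Fin n → ι, ∏ k, M (a k) (a (finRotate n k)) := by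
  obtain ⟨m, rfl⟩ := Nat.exists_eq_add_of_le' hn
  rw [Matrix.trace, ← (Fin.consEquiv fun _ => ι).sum_comp, Fintype.sum_prod_type]
  refine Finset.sum_congr rfl fun i _ => ?_
  rw [Matrix.diag_apply, Matrix.pow_succ_apply_eq_sum_prod]
  refine Finset.sum_congr rfl fun p _ => ?_
  rw [Fin.snoc_eq_cons_rotate]
  rfl

/-! ### Counting permutations and functions -/

/-- The permutations that match `a` with `b` form a coset of the stabilizer of `a`, if there are any;
there are some exactly when all fibres of `a` and `b` have equal cardinality. -/
theorem card_perm_comp_eq {κ ι : Type*} [Fintype κ] [DecidableEq κ] [Fintype ι] [DecidableEq ι]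
    (a b : κ → ι) :
    Fintype.card {σ : Equiv.Perm κ // ∀ k, a k = b (σ k)} =
      ∏ i, if Fintype.card {k // a k = i} = Fintype.card {k // b k = i}
        then (Fintype.card {k // a k = i}).factorial else 0 := by
  by_cases h : ∀ i, Fintype.card {k // a k = i} = Fintype.card {k // b k = i}
  · let τ : Equiv.Perm κ := Equiv.ofFiberEquiv fun i => Fintype.equivOfCardEq (h i)
    have hτ : ∀ k, b (τ k) = a k := fun k => Equiv.ofFiberEquiv_map _ k
    simp only [h, if_true]
    simp only [← h, ← DomMulAct.stabilizer_card a]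
    refine Fintype.card_congr ((Equiv.mulLeft τ⁻¹).subtypeEquiv fun σ => ?_)
    rw [funext_iff]
    refine forall_congr' fun k => ?_
    rw [Function.comp_apply, ← hτ, ← hτ]
    simp [eq_comm]
  · obtain ⟨i, hi⟩ := not_forall.1 h
    rw [Finset.prod_eq_zero (Finset.mem_univ i) (if_neg hi), Fintype.card_eq_zero_iff]
    exact ⟨fun σ => hi (Fintype.card_congr (σ.1.subtypeEquiv fun k => by rw [σ.2 k]))⟩

/-- A function invariant under `σ` is a choice of a value on each cycle. -/
theorem card_comp_perm_eq_self {n : ℕ} (D : ℕ) (σ : Equiv.Perm (Fin n)) :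
    Fintype.card {f : Fin n → Fin D // ∀ k, f k = f (σ k)} = D ^ numCycles σ := by
  classical
  have e : {f : Fin n → Fin D // ∀ k, f k = f (σ k)} ≃
      (Quotient (Equiv.Perm.SameCycle.setoid σ) → Fin D) :=
    { toFun := fun f => Quotient.lift f.1 fun a b hab => by
        obtain ⟨i, hi⟩ := (hab : σ.SameCycle a b)
        rw [← hi]
        have hz : ∀ (i : ℕ) (a : Fin n), f.1 a = f.1 ((σ ^ i) a) := by
          intro i
          induction i with
          | zero => simp
          | succ i ih => intro a; rw [pow_succ', Equiv.Perm.mul_apply, ← f.2, ih]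
        obtain ⟨i, rfl | rfl⟩ := i.eq_nat_or_neg
        · exact hz i a
        · rw [hz i ((σ ^ (-(i : ℤ))) a)]
          simp
      invFun := fun f => ⟨fun k => f ⟦k⟧, fun k => congrArg f
        (Quotient.sound ((Equiv.Perm.sameCycle_apply_right).2 (Equiv.Perm.SameCycle.refl σ k)))⟩
      left_inv := fun f => rfl
      right_inv := fun f => by ext q; induction q using Quotient.ind; rfl }
  rw [numCycles, Nat.card_eq_fintype_card, Fintype.card_congr e, Fintype.card_fun, Fintype.card_fin]

/-! ### Moments of the standard complex Gaussian and Wick's formula -/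

theorem stdComplexGaussian_eq_withDensity : stdComplexGaussian =
    volume.withDensity fun z : ℂ => ENNReal.ofReal (Real.pi⁻¹ * Real.exp (-‖z‖ ^ 2)) := by
  have hv : (1 / 2 : NNReal) ≠ 0 := by norm_num
  have hf : (fun p : ℝ × ℝ => (p.1 : ℂ) + (p.2 : ℂ) * Complex.I) =
      Complex.measurableEquivRealProd.symm := by
    funext p
    apply Complex.ext <;> simp [Complex.measurableEquivRealProd_symm_apply]
  rw [stdComplexGaussian, gaussianReal_of_var_ne_zero _ hv,
    prod_withDensity (measurable_gaussianPDF _ _) (measurable_gaussianPDF _ _), hf,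
    ← Measure.volume_eq_prod]
  have hm : Measurable fun z : ℂ => ENNReal.ofReal (Real.pi⁻¹ * Real.exp (-‖z‖ ^ 2)) := by
    fun_prop
  ext s hs
  rw [MeasurableEquiv.map_apply,
    withDensity_apply _ (Complex.measurableEquivRealProd.symm.measurable hs),
    withDensity_apply _ hs,
    ← Complex.volume_preserving_equiv_real_prod.symm.setLIntegral_comp_preimage_emb
      Complex.measurableEquivRealProd.symm.measurableEmbedding]
  refine setLIntegral_congr_fun (Complex.measurableEquivRealProd.symm.measurable hs) fun p _ => ?_
  simp only [gaussianPDF, gaussianPDFReal]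
  rw [← ENNReal.ofReal_mul (by positivity)]
  congr 1
  have hn : ‖Complex.measurableEquivRealProd.symm p‖ ^ 2 = p.1 ^ 2 + p.2 ^ 2 := by
    rw [Complex.measurableEquivRealProd_symm_apply, ← Complex.normSq_eq_norm_sq,
      Complex.normSq_mk]
    ring
  have hs : (√(2 * Real.pi * ((1 / 2 : NNReal) : ℝ)))⁻¹ *
      (√(2 * Real.pi * ((1 / 2 : NNReal) : ℝ)))⁻¹ = Real.pi⁻¹ := by
    rw [← mul_inv, Real.mul_self_sqrt (by positivity)]
    congr 1
    push_cast
    ring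
  rw [hn, mul_mul_mul_comm, hs, ← Real.exp_add]
  congr 2
  push_cast
  ring

theorem integral_norm_pow_mul_exp (m : ℕ) :
    ∫ z : ℂ, ‖z‖ ^ m * Real.exp (-‖z‖ ^ 2) = Real.pi * Real.Gamma ((m + 2) / 2) := by
  have h := Complex.integral_rpow_mul_exp_neg_rpow (p := 2) (q := m) (by norm_num)
    (by have : (0 : ℝ) ≤ m := m.cast_nonneg
        linarith)
  simp only [Real.rpow_natCast, Real.rpow_ofNat] at h
  rw [h]
  ring

theorem integrable_pow_mul_star_pow_stdComplexGaussian (m m' : ℕ) :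
    Integrable (fun z : ℂ => z ^ m * star z ^ m') stdComplexGaussian := by
  have hi : Integrable (fun z : ℂ => ‖z‖ ^ (m + m') * Real.exp (-‖z‖ ^ 2)) := by
    -- The integral of a non-integrable function is zero by convention, and this one is positive.
    refine not_imp_comm.1 integral_undef ?_
    rw [integral_norm_pow_mul_exp]
    have := Real.Gamma_pos_of_pos (s := (((m + m' : ℕ) : ℝ) + 2) / 2) (by positivity)
    positivity
  rw [stdComplexGaussian_eq_withDensity, integrable_withDensity_iff_integrable_smul' (by fun_prop)
    (by simp)]
  have hr : ∀ z : ℂ, (ENNReal.ofReal (Real.pi⁻¹ * Real.exp (-‖z‖ ^ 2))).toReal =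
    Real.pi⁻¹ * Real.exp (-‖z‖ ^ 2) := fun z => ENNReal.toReal_ofReal (by positivity)
  simp only [hr]
  refine (hi.const_mul Real.pi⁻¹).mono' (by fun_prop) (Filter.Eventually.of_forall fun z => ?_)
  rw [norm_smul, Real.norm_of_nonneg (by positivity), norm_mul, norm_pow, norm_pow, norm_star,
    ← pow_add]
  exact le_of_eq (by ring)

theorem integral_pow_mul_star_pow_stdComplexGaussian (m m' : ℕ) :
    ∫ z, z ^ m * star z ^ m' ∂stdComplexGaussian = if m = m' then (m.factorial : ℂ) else 0 := by
  rw [stdComplexGaussian_eq_withDensity, integral_withDensity_eq_integral_toReal_smul (by fun_prop)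
    (by simp)]
  have hr : ∀ z : ℂ, (ENNReal.ofReal (Real.pi⁻¹ * Real.exp (-‖z‖ ^ 2))).toReal =
    Real.pi⁻¹ * Real.exp (-‖z‖ ^ 2) := fun z => ENNReal.toReal_ofReal (by positivity)
  simp only [hr]
  split_ifs with h
  · subst h
    have hz : ∀ z : ℂ, (Real.pi⁻¹ * Real.exp (-‖z‖ ^ 2)) • (z ^ m * star z ^ m) =
        ((Real.pi⁻¹ * (‖z‖ ^ (2 * m) * Real.exp (-‖z‖ ^ 2)) : ℝ) : ℂ) := fun z => by
      rw [← mul_pow, Complex.star_def, Complex.mul_conj, Complex.normSq_eq_norm_sq,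
        Complex.real_smul, pow_mul]
      push_cast
      ring
    simp only [hz]
    rw [integral_complex_ofReal, integral_const_mul, integral_norm_pow_mul_exp,
      inv_mul_cancel_left₀ Real.pi_ne_zero]
    have : (((2 * m : ℕ) : ℝ) + 2) / 2 = m + 1 := by push_cast; ring
    rw [this, Real.Gamma_nat_eq_factorial]
    simp
  · -- A rotation by the angle `π / (m - m')` preserves the Gaussian weight and flips the sign.
    have hd : (m : ℂ) - m' ≠ 0 := sub_ne_zero.2 (Nat.cast_injective.ne h)
    set t : ℝ := Real.pi / ((m : ℝ) - m') with ht
    set c : Circle := Circle.exp t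
    have hc : (c : ℂ) ^ m * star (c : ℂ) ^ m' = -1 := by
      have hstar : star (c : ℂ) = Complex.exp (-(t * Complex.I)) := by
        rw [Circle.coe_exp, Complex.star_def, ← Complex.exp_conj]
        simp
      rw [hstar, Circle.coe_exp, ← Complex.exp_nat_mul, ← Complex.exp_nat_mul, ← Complex.exp_add,
        ← Complex.exp_pi_mul_I]
      congr 1
      rw [ht]
      push_cast
      field_simp
      ring
    have hrot := (rotation c).measurePreserving.integral_comp
      (rotation c).toHomeomorph.measurableEmbedding
      (fun z : ℂ => (Real.pi⁻¹ * Real.exp (-‖z‖ ^ 2)) • (z ^ m * star z ^ m'))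
    have hz : ∀ z : ℂ, (Real.pi⁻¹ * Real.exp (-‖rotation c z‖ ^ 2)) •
        ((rotation c z) ^ m * star (rotation c z) ^ m') =
        -((Real.pi⁻¹ * Real.exp (-‖z‖ ^ 2)) • (z ^ m * star z ^ m')) := fun z => by
      rw [LinearIsometryEquiv.norm_map, rotation_apply, star_mul', mul_pow, mul_pow,
        mul_mul_mul_comm, hc, neg_one_mul, smul_neg]
    simp only [hz, integral_neg] at hrot
    exact self_eq_neg.1 hrot.symm

theorem prod_comp_eq_prod_pow_card {κ ι M : Type*} [Fintype κ] [Fintype ι] [DecidableEq ι]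
    [CommMonoid M] (a : κ → ι) (f : ι → M) :
    ∏ k, f (a k) = ∏ i, f i ^ Fintype.card {k // a k = i} := by
  rw [← Finset.prod_fiberwise' Finset.univ a]
  refine Finset.prod_congr rfl fun i _ => ?_
  rw [Finset.prod_const, Fintype.card_subtype]

section
variable {V : Type*} [Fintype V] {L : V → Type*} [∀ x, Finite (L x)]
  {Ω : Type*} [MeasurableSpace Ω] {P : Measure Ω}
  {g : (x : V) → Ω → L x → ℂ} {n : ℕ}

/-- Wick's formula for `n` kets and `n` bras at each vertex `x`: the expectation counts the
permutations at each vertex that pair equal indices. Both sides factorize over the variables: the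
exponents of `z` and `star z` must agree, and `m!` counts the pairings of `m` equal indices. -/
theorem integral_prod_mul_star_eq_prod_sum_perm
    (hlaw : ∀ x i, HasLaw (fun ω => g x ω i) stdComplexGaussian P)
    (hindep : iIndepFun (fun (p : Σ x, L x) (ω : Ω) => g p.1 ω p.2) P)
    (a b : (x : V) → Fin n → L x) [∀ x, DecidableEq (L x)] :
    Integrable (fun ω => ∏ x, ∏ k, g x ω (a x k) * star (g x ω (b x k))) P ∧
    ∫ ω, ∏ x, ∏ k, g x ω (a x k) * star (g x ω (b x k)) ∂P =
      ∏ x, ∑ σ : Equiv.Perm (Fin n), if ∀ k, a x k = b x (σ k) then (1 : ℂ) else 0 := by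
  classical
  have := fun x => Fintype.ofFinite (L x)
  let m : (Σ x, L x) → ℕ := fun p => Fintype.card {k // a p.1 k = p.2}
  let m' : (Σ x, L x) → ℕ := fun p => Fintype.card {k // b p.1 k = p.2}
  have hprod : ∀ ω, ∏ x, ∏ k, g x ω (a x k) * star (g x ω (b x k)) =
      ∏ p : Σ x, L x, g p.1 ω p.2 ^ m p * star (g p.1 ω p.2) ^ m' p := fun ω => by
    rw [Fintype.prod_sigma]
    refine Finset.prod_congr rfl fun x _ => ?_
    rw [Finset.prod_mul_distrib, Finset.prod_mul_distrib, prod_comp_eq_prod_pow_card (a x),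
      prod_comp_eq_prod_pow_card (b x) (fun i => star (g x ω i))]
  have hpi := hindep.hasLaw_pi fun p : Σ x, L x => hlaw p.1 p.2
  have hσ : SigmaFinite stdComplexGaussian := by
    rw [stdComplexGaussian_eq_withDensity]
    infer_instance
  have hint : Integrable (fun z : (Σ x, L x) → ℂ => ∏ p, z p ^ m p * star (z p) ^ m' p)
      (Measure.pi fun _ => stdComplexGaussian) :=
    Integrable.fintype_prod_dep (f := fun p z => z ^ m p * star z ^ m' p) fun p =>
      integrable_pow_mul_star_pow_stdComplexGaussian (m p) (m' p)
  simp only [hprod]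
  constructor
  · have h := hint
    rw [← hpi.map_eq] at h
    exact h.comp_aemeasurable hpi.aemeasurable
  · have h := hpi.integral_comp hint.aestronglyMeasurable
    refine h.trans ?_
    rw [integral_fintype_prod_eq_prod (fun p (z : ℂ) => z ^ m p * star z ^ m' p),
      Fintype.prod_sigma]
    refine Finset.prod_congr rfl fun x _ => ?_
    have hc := card_perm_comp_eq (a x) (b x)
    rw [Fintype.card_subtype] at hc
    rw [Finset.sum_boole, hc, Nat.cast_prod]
    refine Finset.prod_congr rfl fun i _ => ?_
    rw [integral_pow_mul_star_pow_stdComplexGaussian]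
    push_cast
    rfl
end

/-! ### Counting leg values compatible with given permutations -/

theorem sum_prod_comm {κ ε X R : Type*} [Fintype κ] [DecidableEq κ] [Fintype ε] [DecidableEq ε]
    [Fintype X] [CommSemiring R] (F : ε → (κ → X) → R) :
    ∑ c : κ → ε → X, ∏ e, F e (fun k => c k e) = ∏ e, ∑ f : κ → X, F e f := by
  rw [Fintype.prod_sum, ← (Equiv.piComm fun (_ : κ) (_ : ε) => X).sum_comp]
  rfl

theorem sum_sum_prod_comm {κ ε X R : Type*} [Fintype κ] [DecidableEq κ] [Fintype ε]
    [DecidableEq ε] [Fintype X] [CommSemiring R] (F : ε → (κ → X) → (κ → X) → R) :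
    ∑ u : κ → ε → X, ∑ v : κ → ε → X, ∏ e, F e (fun k => u k e) (fun k => v k e) =
      ∏ e, ∑ f : κ → X, ∑ h : κ → X, F e f h := by
  rw [← sum_prod_comm (fun e f => ∑ h, F e f h)]
  exact Finset.sum_congr rfl fun u _ => sum_prod_comm fun e h => F e (fun k => u k e) h

theorem sum_match_perm_self {n : ℕ} (D : ℕ) (σ : Equiv.Perm (Fin n)) :
    (∑ f : Fin n → Fin D, if ∀ k, f k = f (σ k) then (1 : ℂ) else 0) =
      (D : ℂ) ^ numCycles σ := by
  have h := card_comp_perm_eq_self D σ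
  rw [Fintype.card_subtype] at h
  rw [Finset.sum_boole, h, Nat.cast_pow]

/-- The bra values `h` are determined by the ket values `f` through `α`; the condition left on `f` is
invariance under `α⁻¹ * β`. -/
theorem sum_sum_match_perm {n : ℕ} (D : ℕ) (α β : Equiv.Perm (Fin n)) :
    (∑ f : Fin n → Fin D, ∑ h : Fin n → Fin D,
      if ∀ k, f k = h (α k) ∧ f k = h (β k) then (1 : ℂ) else 0) =
      (D : ℂ) ^ numCycles (α⁻¹ * β) := by
  rw [← sum_match_perm_self]
  refine Finset.sum_congr rfl fun f _ => ?_
  rw [Finset.sum_eq_single (f ∘ ⇑α⁻¹)]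
  · refine if_congr (forall_congr' fun k => ?_) rfl rfl
    simp
  · intro h _ hne
    refine if_neg fun H => hne (funext fun k => ?_)
    simpa using (H (α⁻¹ k)).1.symm
  · simp

/-! ### Expanding the trace over leg values -/

/-- The permutation of the `n` replicas such that, in `Tr (ρ_A ^ n)`, the bra of replica `k` carries
at the half-edge `e` the value in the ket of replica `boundaryPerm A n e k`. That is replica `k + 1`
on `A`, by the matrix product and the trace, and replica `k` off `A`, by the partial trace. -/
def boundaryPerm {Ed : Type*} [DecidableEq Ed] (A : Finset Ed) (n : ℕ) (e : Ed) :
    Equiv.Perm (Fin n) :=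
  if e ∈ A then finRotate n else 1

/-- The sums over the values on `A` (matrix indices) and on its complement (partial trace) merge
into one sum over a value in each replica at each half-edge. -/
theorem trace_partialTraceCompl_pow {Ed : Type*} [Fintype Ed] [DecidableEq Ed] (D : ℕ)
    (A : Finset Ed) (ψ : (Ed → Fin D) → ℂ) {n : ℕ} (hn : 1 ≤ n) :
    (partialTraceCompl D A (Matrix.vecMulVec ψ (star ψ)) ^ n).trace =
      ∑ c : Fin n → Ed → Fin D, ∏ k, ψ (c k) * star (ψ fun e => c (boundaryPerm A n e k) e) := by
  let s := Equiv.piEquivPiSubtypeProd (fun e => e ∈ A) (fun _ => Fin D)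
  let E : (Fin n → Ed → Fin D) ≃
      (Fin n → {e // e ∈ A} → Fin D) × (Fin n → {e // e ∉ A} → Fin D) :=
    (Equiv.piCongrRight fun _ => s).trans (Equiv.arrowProdEquivProdArrow _ _ _)
  rw [Matrix.trace_pow_eq_sum_prod _ hn]
  simp only [partialTraceCompl, Fintype.prod_sum]
  rw [← Fintype.sum_prod_type', ← E.sum_comp]
  refine Finset.sum_congr rfl fun c _ => Finset.prod_congr rfl fun k _ => ?_
  rw [Matrix.vecMulVec_apply, Pi.star_apply]
  congr 3
  · exact s.symm_apply_apply (c k)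
  · funext e
    by_cases he : e ∈ A <;>
      simp [E, s, boundaryPerm, he, Equiv.piEquivPiSubtypeProd, Equiv.arrowProdEquivProdArrow]

namespace OpenGraph
variable {V Eb Ed : Type*} (G : OpenGraph V Eb Ed)

/-- The value at each leg given by values `c` at the half-edges and `u` at the bulk edges, both ends
of a bulk edge receiving the same value. -/
def legValue {D : ℕ} (c : Ed → Fin D) (u : Eb → Fin D) : Ed ⊕ Eb × Bool → Fin D :=
  Sum.elim c fun p => u p.1

/-- The maximally entangled states force equal values at the two ends of each bulk edge, and
contribute a factor `D ^ (-1/2)` for each such edge. -/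
theorem networkState_eq_sum [Fintype V] [Fintype Eb] [DecidableEq Eb] (D : ℕ)
    (g : (x : V) → G.LocalIndex D x → ℂ) (c : Ed → Fin D) :
    G.networkState D g c = ((1 / √(D : ℝ) : ℝ) : ℂ) ^ Fintype.card Eb *
      ∑ u : Eb → Fin D, G.vertexState D g (legValue c u) := by
  rw [networkState, Finset.mul_sum]
  refine (Fintype.sum_of_injective (fun (u : Eb → Fin D) (p : Eb × Bool) => u p.1)
    ?_ _ _ ?_ ?_).symm
  · intro u v h
    exact funext fun e => congrFun h (e, false)
  · intro j hj
    obtain ⟨e, he⟩ : ∃ e, j (e, false) ≠ j (e, true) := by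
      by_contra! h
      refine hj ⟨fun e => j (e, false), funext fun p => ?_⟩
      obtain ⟨e, rfl | rfl⟩ := p
      · rfl
      · exact h e
    rw [edgeState, Finset.prod_eq_zero (Finset.mem_univ e) (by simp [maxEntangled, he]), star_zero,
      zero_mul]
  · intro u
    simp [edgeState, maxEntangled, legValue]

/-- `Tr (ρ_A ^ n)` as a polynomial in the vertex states: `w.1` holds the values at the half-edges,
and `w.2.1` and `w.2.2` those at the bulk edges in the kets and in the bras. -/
theorem trace_reducedState_pow [Fintype V] [Fintype Eb] [DecidableEq Eb] [Fintype Ed]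
    [DecidableEq Ed] (D : ℕ) (A : Finset Ed) {n : ℕ} (hn : 1 ≤ n)
    (g : (x : V) → G.LocalIndex D x → ℂ) :
    (G.reducedState D A g ^ n).trace = ((D : ℂ)⁻¹) ^ (n * Fintype.card Eb) *
      ∑ w : (Fin n → Ed → Fin D) × (Fin n → Eb → Fin D) × (Fin n → Eb → Fin D),
        ∏ x, ∏ k, g x (fun l => legValue (w.1 k) (w.2.1 k) l) *
          star (g x fun l =>
            legValue (fun e => w.1 (boundaryPerm A n e k) e) (w.2.2 k) l) := by
  have hκ : ((1 / √(D : ℝ) : ℝ) : ℂ) * star ((1 / √(D : ℝ) : ℝ) : ℂ) = (D : ℂ)⁻¹ := by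
    rw [Complex.star_def, Complex.conj_ofReal, ← Complex.ofReal_mul, div_mul_div_comm,
      Real.mul_self_sqrt D.cast_nonneg]
    simp
  rw [reducedState, trace_partialTraceCompl_pow D A _ hn, Fintype.sum_prod_type, Finset.mul_sum]
  refine Finset.sum_congr rfl fun c _ => ?_
  rw [Fintype.sum_prod_type]
  simp only [networkState_eq_sum, star_mul', star_pow, mul_mul_mul_comm, ← mul_pow, hκ]
  rw [Finset.prod_mul_distrib, Finset.prod_const, Finset.card_univ, Fintype.card_fin, ← pow_mul,
    mul_comm (Fintype.card Eb), Finset.prod_mul_distrib]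
  simp only [star_sum, Fintype.prod_sum]
  rw [Finset.sum_mul_sum]
  congr 1
  refine Finset.sum_congr rfl fun u _ => Finset.sum_congr rfl fun v _ => ?_
  rw [← Finset.prod_mul_distrib, Finset.prod_comm]
  refine Finset.prod_congr rfl fun k _ => ?_
  rw [vertexState, vertexState, star_prod, Finset.prod_mul_distrib]

/-- Matching the local indices of kets and bras vertex by vertex is the same as matching the values
leg by leg, so each term of the sum over configurations `α` factorizes over the half-edges and the
bulk edges. -/
theorem prod_sum_match [Fintype V] [DecidableEq V] [Fintype Eb] [Fintype Ed] {D n : ℕ}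
    (τ : Ed → Equiv.Perm (Fin n)) (c : Fin n → Ed → Fin D) (u v : Fin n → Eb → Fin D)
    [∀ x, DecidableEq (G.LocalIndex D x)] :
    (∏ x : V, ∑ σ : Equiv.Perm (Fin n),
      if ∀ k, (fun l => legValue (c k) (u k) l.1 : G.LocalIndex D x) =
        fun l => legValue (fun e => c (τ e (σ k)) e) (v (σ k)) l.1 then (1 : ℂ) else 0) =
    ∑ α : V → Equiv.Perm (Fin n),
      (∏ e, if ∀ k, c k e = c (τ e (α (G.root e) k)) e then 1 else 0) *
      ∏ e, if ∀ k, u k e = v (α (G.fst e) k) e ∧ u k e = v (α (G.snd e) k) e then 1 else 0 := by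
  classical
  rw [Fintype.prod_sum]
  refine Finset.sum_congr rfl fun α _ => ?_
  simp only [Fintype.prod_boole]
  rw [ite_zero_mul_ite_zero, mul_one]
  refine if_congr ?_ rfl rfl
  constructor
  · intro h
    refine ⟨fun e k => congrFun (h (G.root e) k) ⟨Sum.inl e, rfl⟩, fun e k => ⟨?_, ?_⟩⟩
    · exact congrFun (h (G.fst e) k) ⟨Sum.inr (e, false), rfl⟩
    · exact congrFun (h (G.snd e) k) ⟨Sum.inr (e, true), rfl⟩
  · rintro ⟨h₁, h₂⟩ x k
    funext ⟨l, hl⟩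
    subst hl
    obtain e | ⟨e, _ | _⟩ := l
    · exact h₁ e k
    · exact (h₂ e k).1
    · exact (h₂ e k).2

theorem exponent_sub_hamiltonian_eq [Fintype Eb] [Fintype Ed] [DecidableEq Ed] (A : Finset Ed) (n : ℕ)
    (α : V → Equiv.Perm (Fin n)) :
    (n : ℤ) * (Fintype.card (Eb ⊕ Ed) : ℤ) - (n : ℤ) * (Fintype.card Eb : ℤ)
        - G.hamiltonian A n α =
      -((n * Fintype.card Eb : ℕ) : ℤ)
        + ((∑ e, numCycles (boundaryPerm A n e * α (G.root e)) : ℕ) : ℤ)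
        + ((∑ e, numCycles ((α (G.fst e))⁻¹ * α (G.snd e)) : ℕ) : ℤ) := by
  have hA : ∑ e ∈ A, cayleyDist (totalCycle n) (α (G.root e)) =
      ∑ e ∈ A, ((n : ℤ) - numCycles (boundaryPerm A n e * α (G.root e))) :=
    Finset.sum_congr rfl fun e he => by
      rw [cayleyDist, totalCycle, inv_inv, boundaryPerm, if_pos he]
  have hB : ∑ e ∈ Aᶜ, cayleyDist 1 (α (G.root e)) =
      ∑ e ∈ Aᶜ, ((n : ℤ) - numCycles (boundaryPerm A n e * α (G.root e))) :=
    Finset.sum_congr rfl fun e he => by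
      rw [cayleyDist, inv_one, boundaryPerm, if_neg (Finset.mem_compl.1 he)]
  rw [hamiltonian, hA, hB, Finset.sum_add_sum_compl, Fintype.card_sum]
  simp only [cayleyDist, Finset.sum_sub_distrib, Finset.sum_const, Finset.card_univ, nsmul_eq_mul]
  push_cast
  ring

end OpenGraph

/-! ### The moments of the reduced state -/

theorem proposition4p1 {V Eb Ed : Type*} [Fintype V] [DecidableEq V] [Fintype Eb] [DecidableEq Eb]
    [Fintype Ed] [DecidableEq Ed] (G : OpenGraph V Eb Ed) (D : ℕ) (hD : 1 ≤ D)
    {Ω : Type*} [MeasurableSpace Ω] (P : Measure Ω) [IsProbabilityMeasure P]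
    (g : (x : V) → Ω → G.LocalIndex D x → ℂ)
    (hlaw : ∀ (x : V) (i : G.LocalIndex D x), HasLaw (fun ω => g x ω i) stdComplexGaussian P)
    (hindep : iIndepFun (fun (p : Σ x : V, G.LocalIndex D x) (ω : Ω) => g p.1 ω p.2) P)
    (A : Finset Ed) (n : ℕ) (hn : 1 ≤ n) :
    Integrable (fun ω => ((G.reducedState D A (fun x => g x ω)) ^ n).trace) P ∧
      ∫ ω, ((G.reducedState D A (fun x => g x ω)) ^ n).trace ∂P =
        ∑ α : V → Equiv.Perm (Fin n),
          (D : ℂ) ^ ((n : ℤ) * (Fintype.card (Eb ⊕ Ed) : ℤ) - (n : ℤ) * (Fintype.card Eb : ℤ)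
            - G.hamiltonian A n α) := by
  classical
  have hD' : (D : ℂ) ≠ 0 := Nat.cast_ne_zero.2 (by omega)
  have hw := fun w : (Fin n → Ed → Fin D) × (Fin n → Eb → Fin D) × (Fin n → Eb → Fin D) =>
    integral_prod_mul_star_eq_prod_sum_perm hlaw hindep (fun x k l => OpenGraph.legValue (w.1 k) (w.2.1 k) l)
      (fun x k l => OpenGraph.legValue (fun e => w.1 (boundaryPerm A n e k) e) (w.2.2 k) l)
  simp only [G.trace_reducedState_pow D A hn]
  refine ⟨(integrable_finsetSum _ fun w _ => (hw w).1).const_mul _, ?_⟩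
  rw [integral_const_mul, integral_finsetSum _ fun w _ => (hw w).1]
  simp only [fun w => (hw w).2, G.prod_sum_match]
  rw [Finset.sum_comm, Finset.mul_sum]
  refine Finset.sum_congr rfl fun α _ => ?_
  let F (e : Ed) (f : Fin n → Fin D) : ℂ :=
    if ∀ k, f k = f (boundaryPerm A n e (α (G.root e) k)) then 1 else 0
  let K (e : Eb) (f h : Fin n → Fin D) : ℂ :=
    if ∀ k, f k = h (α (G.fst e) k) ∧ f k = h (α (G.snd e) k) then 1 else 0
  -- For a fixed configuration the sum over leg values splits into one sum for each edge.
  rw [Fintype.sum_prod_type]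
  refine (congrArg _ (Fintype.sum_mul_sum
    (fun c : Fin n → Ed → Fin D => ∏ e, F e fun k => c k e)
    fun w : (Fin n → Eb → Fin D) × (Fin n → Eb → Fin D) =>
      ∏ e, K e (fun k => w.1 k e) fun k => w.2 k e).symm).trans ?_
  rw [Fintype.sum_prod_type, sum_prod_comm, sum_sum_prod_comm]
  have hF : ∀ e, ∑ f, F e f = (D : ℂ) ^ numCycles (boundaryPerm A n e * α (G.root e)) := fun e =>
    sum_match_perm_self D (boundaryPerm A n e * α (G.root e))
  have hK : ∀ e, ∑ f, ∑ h, K e f h = (D : ℂ) ^ numCycles ((α (G.fst e))⁻¹ * α (G.snd e)) :=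
    fun e => sum_sum_match_perm D (α (G.fst e)) (α (G.snd e))
  simp only [hF, hK]
  rw [Finset.prod_pow_eq_pow_sum, Finset.prod_pow_eq_pow_sum, G.exponent_sub_hamiltonian_eq, zpow_add₀ hD',
    zpow_add₀ hD', zpow_neg, zpow_natCast, zpow_natCast, zpow_natCast, inv_pow, mul_assoc]
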